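/- \textbf{Theorem (Compressed SSC on noiseless data).} Let $\mathcal U^{(1)},\dots,\mathcal U^{(k)}\subseteq\mathbb R^d$ be linear subspaces and let $x_1,\dots,x_N\in\mathbb R^d$ be unit vectors (the columns of $\mathbf X$), each assigned to one cluster $\ell\in\{1,\dots,k\}$ with $x_i\in\mathcal U^{(\ell)}$. Write $\mathbf X^{(\ell)}$ for the points of cluster $\ell$ and $\mathbf X^{(\ell)}_{-i}$ for these points without $x_i$. Let $\lambda>0$. \emph{Subspace incoherence.} For $x_i$ in cluster $\ell$ let the dual direction $\nu(x_i)$ be the unique maximizer of $\langle x_i,\nu\rangle-\frac{\lambda}{2}\|\nu\|_2^2$ over all $\nu\in\mathbb R^d$ with $|\langle x_j,\nu\rangle|\le 1$ for all columns $x_j$ of $\mathbf X^{(\ell)}_{-i}$. Put $v(x_i)=\mathcal P_{\mathcal U^{(\ell)}}\nu(x_i)/\|\mathcal P_{\mathcal U^{(\ell)}}\nu(x_i)\|_2$, where $\mathcal P_{\mathcal U^{(\ell)}}$ is the orthogonal projection onto $\mathcal U^{(\ell)}$, and $$\mu_\ell=\max\{|\langle v(x_i),x_j\rangle| : x_i \text{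 in cluster } \ell,\ x_j \text{ not in cluster } \ell\},$$ with $\mu_\ell=0$ if there is no such pair. \emph{Inradius.} Let $\rho_\ell=\min_{i}\, r(\mathcal Q(\mathbf X^{(\ell)}_{-i}))$, the minimum running over the points $x_i$ of cluster $\ell$, where $\mathcal Q(\mathbf A)$ is the convex hull of the columns of $\mathbf A$ and their negatives, and $r(\cdot)$ is the radius of the largest ball of $\mathcal U^{(\ell)}$ contained in it ($0$ if there is none); put $\rho_\ell=0$ if cluster $\ell$ has no points. Let $\rho=\min_\ell\rho_\ell$ and $\Delta=\min_\ell(\rho_\ell-\mu_\ell)$. There is an absolute constant $K>0$ (independent of $d,p,N,k$, the data, $\mathbf\Psi$, $\lambda$ and $\epsilon$) for which the following holds. Assume $\mu_\ell<\rho_\ell$ for all $\ell$, and $0<\lambda<\rho/2$. Let $\mathbf\Psi\in\mathbb R^{p\times d}$ and $\epsilon$ satisfy $$\big|\langle x,y\rangle-\langle\mathbf\Psi x,\mathbf\Psi y\rangle\big|\le\epsilon\,\frac{\|x\|_2^2+\|y\|_2^2}{2}\qquad\text{for all }\ell,\ell'\text{ and all }x,y\in\mathcal U^{(\ell)}\cup\mathcal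 U^{(\ell')},$$ $$(1-\epsilon)\|x_i\|_2^2\le\|\mathbf\Psi x_i\|_2^2\le(1+\epsilon)\|x_i\|_2^2\qquad\text{for all }i,$$ and suppose that $$\epsilon\le K\,\Delta^2\lambda^{3/2}.$$ Let $\tilde x_i'=\mathbf\Psi x_i/\|\mathbf\Psi x_i\|_2$. Then Lasso SSC on $\tilde x_1',\dots,\tilde x_N'$ has the subspace detection property: whenever, for each $i$, $c_i\in\mathbb R^N$ minimizes $\|\tilde x_i'-\sum_j c_{ij}\tilde x_j'\|_2^2+2\lambda\|c_i\|_1$ subject to $c_{ii}=0$, one has, for each $i$, $c_i\ne 0$, and $c_{ij}\neq0$ only if $x_i$ and $x_j$ are in the same cluster. -/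

import Mathlib

noncomputable section

namespace CompressedSSC

/-- The Euclidean space of real vectors with `d` coordinates. -/
abbrev Vec (d : ℕ) := EuclideanSpace ℝ (Fin d)

/-! ### Lasso sparse subspace clustering -/

/-- The Lasso objective for the data point `x i`:
`‖x_i - ∑_j c_j x_j‖² + 2 lam ‖c‖₁`. -/
def lassoObjective {d N : ℕ} (lam : ℝ) (x : Fin N → Vec d) (i : Fin N) (c : Fin N → ℝ) : ℝ :=
  ‖x i - ∑ j, c j • x j‖ ^ 2 + 2 * lam * ∑ j, |c j|

/-- `C` is an output of Lasso SSC on the data `x`: for each `i`, the vector `c_i = C i`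
minimizes the Lasso objective for `x i` among all `c` with `c i = 0`. -/
def IsLassoSSCSolution {d N : ℕ} (lam : ℝ) (x : Fin N → Vec d) (C : Fin N → Fin N → ℝ) : Prop :=
  ∀ i, C i i = 0 ∧
    ∀ c : Fin N → ℝ, c i = 0 → lassoObjective lam x i (C i) ≤ lassoObjective lam x i c

/-- Subspace detection property of a similarity matrix, where `z i` is the cluster of the `i`th
data point: every `c_i` is nonzero, and `c_ij ≠ 0` only for `i`, `j` in the same cluster. -/
def SubspaceDetectionProperty {N k : ℕ} (z : Fin N → Fin k) (C : Fin N → Fin N → ℝ) : Prop :=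
  ∀ i, C i ≠ 0 ∧ ∀ j, C i j ≠ 0 → z i = z j

/-- Lasso SSC with parameter `lam` on the data `x` has the subspace detection property: every
solution of the Lasso problems (they need not be unique) has it. -/
def LassoSSCDetects {d N k : ℕ} (lam : ℝ) (x : Fin N → Vec d) (z : Fin N → Fin k) : Prop :=
  ∀ C : Fin N → Fin N → ℝ, IsLassoSSCSolution lam x C → SubspaceDetectionProperty z C

/-! ### Dual directions and subspace incoherence -/

/-- Feasibility in the dual problem: `|⟨a, ν⟩| ≤ 1` for all columns `a ∈ A`. -/
def DualFeasible {d : ℕ} (A : Set (Vec d)) (ν : Vec d) : Prop :=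
  ∀ a ∈ A, |inner ℝ a ν| ≤ 1

/-- The dual objective `⟨x, ν⟩ - (lam / 2) ⟨ν, ν⟩`. -/
def dualObjective {d : ℕ} (lam : ℝ) (x ν : Vec d) : ℝ :=
  inner ℝ x ν - lam / 2 * ‖ν‖ ^ 2

/-- `ν` solves the dual problem: maximize `dualObjective lam x` over the feasible vectors. -/
def IsDualDirection {d : ℕ} (lam : ℝ) (x : Vec d) (A : Set (Vec d)) (ν : Vec d) : Prop :=
  DualFeasible A ν ∧ ∀ ν', DualFeasible A ν' → dualObjective lam x ν' ≤ dualObjective lam x ν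

theorem dualObjective_eq {d : ℕ} {lam : ℝ} (hlam : 0 < lam) (x ν : Vec d) :
    dualObjective lam x ν
      = ‖x‖ ^ 2 / (2 * lam) - lam / 2 * ‖lam⁻¹ • x - ν‖ ^ 2 := by
  have h := @norm_sub_sq_real (Vec d) _ _ (lam⁻¹ • x) ν
  rw [h, inner_smul_left, norm_smul, Real.norm_eq_abs, abs_of_pos (inv_pos.2 hlam)]
  simp only [dualObjective, conj_trivial]
  field_simp
  ring

theorem convex_dualFeasible {d : ℕ} (A : Set (Vec d)) : Convex ℝ {ν | DualFeasible A ν} := by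
  intro u hu v hv s t hs ht hst a ha
  have h1 := abs_le.1 (hu a ha)
  have h2 := abs_le.1 (hv a ha)
  rw [inner_add_right, inner_smul_right, inner_smul_right, abs_le]
  constructor <;> nlinarith

theorem isClosed_dualFeasible {d : ℕ} (A : Set (Vec d)) : IsClosed {ν | DualFeasible A ν} := by
  have : {ν : Vec d | DualFeasible A ν} = ⋂ a ∈ A, {ν | |inner ℝ a ν| ≤ 1} := by
    ext ν; simp [DualFeasible]
  rw [this]
  exact isClosed_biInter fun a _ =>
    isClosed_le (continuous_abs.comp (continuous_const.inner continuous_id)) continuous_const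

/-- For `lam > 0` the dual problem has exactly one solution. -/
theorem existsUnique_isDualDirection {d : ℕ} {lam : ℝ} (hlam : 0 < lam) (x : Vec d)
    (A : Set (Vec d)) : ∃! ν, IsDualDirection lam x A ν := by
  have hne : {ν : Vec d | DualFeasible A ν}.Nonempty := ⟨0, fun a _ => by simp⟩
  obtain ⟨ν, hν, hdist⟩ := (isClosed_dualFeasible A).exists_infDist_eq_dist hne (lam⁻¹ • x)
  refine ⟨ν, ⟨hν, fun ν' hν' => ?_⟩, fun w hw => ?_⟩
  · have h : ‖lam⁻¹ • x - ν‖ ≤ ‖lam⁻¹ • x - ν'‖ := by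
      rw [← dist_eq_norm, ← dist_eq_norm, ← hdist]
      exact Metric.infDist_le_dist_of_mem hν'
    rw [dualObjective_eq hlam, dualObjective_eq hlam]
    have h2 := pow_le_pow_left₀ (norm_nonneg _) h 2
    nlinarith
  · have hmid : DualFeasible A ((1 / 2 : ℝ) • w + (1 / 2 : ℝ) • ν) :=
      convex_dualFeasible A hw.1 hν (by norm_num) (by norm_num) (by norm_num)
    have hm := hw.2 _ hmid
    have hn : ‖lam⁻¹ • x - ν‖ ≤ ‖lam⁻¹ • x - w‖ := by
      rw [← dist_eq_norm, ← dist_eq_norm, ← hdist]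
      exact Metric.infDist_le_dist_of_mem hw.1
    rw [dualObjective_eq hlam, dualObjective_eq hlam] at hm
    have hp := parallelogram_law_with_norm ℝ (lam⁻¹ • x - w) (lam⁻¹ • x - ν)
    have e1 : lam⁻¹ • x - w + (lam⁻¹ • x - ν)
        = (2 : ℝ) • (lam⁻¹ • x - ((1 / 2 : ℝ) • w + (1 / 2 : ℝ) • ν)) := by module
    have e2 : lam⁻¹ • x - w - (lam⁻¹ • x - ν) = -(w - ν) := by module
    rw [e1, e2, norm_neg, norm_smul, Real.norm_two] at hp
    have hn2 := pow_le_pow_left₀ (norm_nonneg _) hn 2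
    have hm2 : ‖lam⁻¹ • x - w‖ ^ 2
        ≤ ‖lam⁻¹ • x - ((1 / 2 : ℝ) • w + (1 / 2 : ℝ) • ν)‖ ^ 2 := by
      by_contra hcon
      push Not at hcon
      nlinarith
    have h0 : ‖w - ν‖ = 0 := by
      have : ‖w - ν‖ * ‖w - ν‖ ≤ 0 := by nlinarith
      nlinarith [norm_nonneg (w - ν)]
    exact sub_eq_zero.1 (norm_eq_zero.1 h0)

/-- The dual direction: the solution of the dual problem (unique for `lam > 0`). -/
def dualDirection {d : ℕ} (lam : ℝ) (x : Vec d) (A : Set (Vec d)) : Vec d :=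
  Classical.epsilon (IsDualDirection lam x A)

theorem isDualDirection_dualDirection {d : ℕ} {lam : ℝ} (hlam : 0 < lam) (x : Vec d)
    (A : Set (Vec d)) : IsDualDirection lam x A (dualDirection lam x A) :=
  Classical.epsilon_spec (existsUnique_isDualDirection hlam x A).exists

/-- The columns of the cluster of `x i`, with the `i`th column left out. -/
def clusterWithout {d N k : ℕ} (x : Fin N → Vec d) (z : Fin N → Fin k) (i : Fin N) :
    Set (Vec d) :=
  {a | ∃ j, j ≠ i ∧ z j = z i ∧ a = x j}

/-- The normalized dual direction `v(x_i) = P_U ν(x_i) / ‖P_U ν(x_i)‖`, where `U` is the subspace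
of the cluster of `x_i` and `ν(x_i)` is the dual direction of `x_i` with respect to the other
points of that cluster. -/
def normalizedDualDirection {d N k : ℕ} (lam : ℝ) (U : Fin k → Submodule ℝ (Vec d))
    (x : Fin N → Vec d) (z : Fin N → Fin k) (i : Fin N) : Vec d :=
  let w := (U (z i)).starProjection (dualDirection lam (x i) (clusterWithout x z i))
  ‖w‖⁻¹ • w

/-- Subspace incoherence `μ_ℓ`: the maximum of `|⟨v(x_i), x_j⟩|` over the points `x_i` of cluster
`ℓ` and the points `x_j` of all other clusters (`0` if there is no such pair). -/
def subspaceIncoherence {d N k : ℕ} (lam : ℝ) (U : Fin k → Submodule ℝ (Vec d))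
    (x : Fin N → Vec d) (z : Fin N → Fin k) (ℓ : Fin k) : ℝ :=
  sSup {t | ∃ i j, z i = ℓ ∧ z j ≠ ℓ ∧
    t = |inner ℝ (normalizedDualDirection lam U x z i) (x j)|}

/-! ### Inradius -/

/-- The symmetric convex hull `conv(± a : a ∈ A)`. -/
def symmConvexHull {d : ℕ} (A : Set (Vec d)) : Set (Vec d) :=
  convexHull ℝ (A ∪ {a | -a ∈ A})

/-- The radius of the largest ball of the subspace `U` that is contained in `K`. -/
def inradiusIn {d : ℕ} (U : Submodule ℝ (Vec d)) (K : Set (Vec d)) : ℝ :=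
  sSup {R | 0 ≤ R ∧ ∃ c ∈ U, Metric.closedBall c R ∩ (U : Set (Vec d)) ⊆ K}

/-- The inradius `ρ_ℓ`: the minimum, over the points `x_i` of cluster `ℓ`, of the inradius in `U ℓ`
of the symmetric convex hull of the other points of the cluster. -/
def clusterInradius {d N k : ℕ} (U : Fin k → Submodule ℝ (Vec d))
    (x : Fin N → Vec d) (z : Fin N → Fin k) (ℓ : Fin k) : ℝ :=
  ⨅ i : {i : Fin N // z i = ℓ}, inradiusIn (U ℓ) (symmConvexHull (clusterWithout x z i))

/-! ### Compression -/

/-- The action of a `p × d` matrix as a map between Euclidean spaces. -/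
def project {d p : ℕ} (Ψ : Matrix (Fin p) (Fin d) ℝ) (u : Vec d) : Vec p :=
  Matrix.toEuclideanLin Ψ u

/-- `Ψ` preserves, up to `ε`, inner products on `U ℓ ∪ U ℓ'` for all `ℓ`, `ℓ'`, and the norms of
the data points. -/
def PreservesGeometry {d p N k : ℕ} (Ψ : Matrix (Fin p) (Fin d) ℝ)
    (U : Fin k → Submodule ℝ (Vec d)) (x : Fin N → Vec d) (ε : ℝ) : Prop :=
  (∀ ℓ ℓ' : Fin k, ∀ u ∈ (U ℓ : Set (Vec d)) ∪ (U ℓ' : Set (Vec d)),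
    ∀ v ∈ (U ℓ : Set (Vec d)) ∪ (U ℓ' : Set (Vec d)),
      |inner ℝ u v - inner ℝ (project Ψ u) (project Ψ v)|
        ≤ ε * ((‖u‖ ^ 2 + ‖v‖ ^ 2) / 2)) ∧
  ∀ i, (1 - ε) * ‖x i‖ ^ 2 ≤ ‖project Ψ (x i)‖ ^ 2 ∧
    ‖project Ψ (x i)‖ ^ 2 ≤ (1 + ε) * ‖x i‖ ^ 2

/-- The projected data, with each column rescaled to unit norm. -/
def compressedData {d p N : ℕ} (Ψ : Matrix (Fin p) (Fin d) ℝ) (x : Fin N → Vec d) :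
    Fin N → Vec p :=
  fun i => ‖project Ψ (x i)‖⁻¹ • project Ψ (x i)

end CompressedSSC

end

namespace CompressedSSC

/-! ### Optimality conditions for the Lasso -/

/-! The residual of a Lasso solution, divided by `lam`, is a dual vector, and a dual vector strictly
feasible on the other clusters certifies that no Lasso solution uses them. Solve the compressed
Lasso with coefficients restricted to the cluster of `x i`. Its residual is `lam • project Ψ w` with
`w` in the subspace of that cluster, so `w` almost solves the uncompressed dual problem. That
problem is strongly concave with modulus `lam`, hence `‖w - ν‖ ^ 2` is of order `ε / (lam * ρ ^ 2)`,
where `ν` is the projected dual direction (`dual_stability`). Since `‖ν‖ ≤ 1 / ρ`, incoherence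
bounds `|⟨x j, ν⟩|` by `μ / ρ < 1` for `x j` in another cluster. The gap `ρ - μ` absorbs the
perturbation (`compressed_dual_strictly_feasible`), and `lasso_support_subset` concludes. A zero
solution would make all correlations with `x i` in the compressed cluster at most `lam`; the
inradius forbids this, as `lam < ρ / 2`. -/

theorem nonneg_of_forall_quadratic_nonneg {a b : ℝ}
    (h : ∀ t : ℝ, 0 < t → t ≤ 1 → 0 ≤ t ^ 2 * a + t * b) : 0 ≤ b := by
  by_contra hb
  push Not at hb
  have hd : 0 < |a| + -b := by linarith [abs_nonneg a]
  -- For this `t`, `t * |a| ≤ -b / 2`, so `t * a + b ≤ b / 2 < 0`.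
  have h1 := h (-b / (2 * (|a| + -b))) (div_pos (by linarith) (by linarith))
    ((div_le_one (by linarith)).2 (by linarith [abs_nonneg a]))
  set t := -b / (2 * (|a| + -b)) with ht
  have htpos : 0 < t := div_pos (by linarith) (by linarith)
  have h2 : t * (2 * (|a| + -b)) = -b := by
    rw [ht]
    field_simp
  have h3 : 0 ≤ t * a + b := by
    have : 0 ≤ t * (t * a + b) := by linarith
    exact nonneg_of_mul_nonneg_right this htpos
  nlinarith [le_abs_self a]

/-- The Lasso objective along a coordinate direction. -/
theorem lassoObjective_add_single {d N : ℕ} (lam : ℝ) (y : Fin N → Vec d) (i j : Fin N)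
    (c : Fin N → ℝ) (t : ℝ) :
    lassoObjective lam y i (c + Pi.single j t) = lassoObjective lam y i c
      + (t ^ 2 * ‖y j‖ ^ 2 - 2 * t * inner ℝ (y j) (y i - ∑ k, c k • y k)
        + 2 * lam * (|c j + t| - |c j|)) := by
  have h1 : ∑ k, (c + Pi.single j t : Fin N → ℝ) k • y k = ∑ k, c k • y k + t • y j := by
    simp only [Pi.add_apply, add_smul, Finset.sum_add_distrib]
    congr 1
    rw [Finset.sum_eq_single j]
    · simp
    · intro b _ hb
      simp [Pi.single_eq_of_ne hb]
    · simp
  have h2 : ∑ k, |(c + Pi.single j t : Fin N → ℝ) k| - ∑ k, |c k| = |c j + t| - |c j| := by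
    rw [← Finset.sum_sub_distrib, Finset.sum_eq_single j]
    · simp
    · intro b _ hb
      simp [Pi.single_eq_of_ne hb]
    · simp
  have h3 : y i - (∑ k, c k • y k + t • y j) = (y i - ∑ k, c k • y k) - t • y j := by abel
  unfold lassoObjective
  rw [h1, h3, norm_sub_sq_real, real_inner_smul_right, norm_smul, mul_pow, Real.norm_eq_abs,
    sq_abs, real_inner_comm, ← h2]
  ring

/-- Optimality conditions for the Lasso with coefficients supported in `S`. -/
theorem lasso_optimality {d N : ℕ} {lam : ℝ} {y : Fin N → Vec d} {i : Fin N}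
    {S : Set (Fin N)} {c : Fin N → ℝ} (hc : ∀ j, j ∉ S → c j = 0)
    (hmin : ∀ c' : Fin N → ℝ, (∀ j, j ∉ S → c' j = 0) →
      lassoObjective lam y i c ≤ lassoObjective lam y i c') (hlam : 0 < lam)
    {j : Fin N} (hj : j ∈ S) :
    |inner ℝ (y j) (y i - ∑ k, c k • y k)| ≤ lam ∧
      c j * inner ℝ (y j) (y i - ∑ k, c k • y k) = lam * |c j| := by
  have key : ∀ t : ℝ, 0 ≤ t ^ 2 * ‖y j‖ ^ 2 - 2 * t * inner ℝ (y j) (y i - ∑ k, c k • y k)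
      + 2 * lam * (|c j + t| - |c j|) := by
    intro t
    have h := hmin (c + Pi.single j t) (fun k hk => by
      have hkj : k ≠ j := fun h => hk (h ▸ hj)
      simp [Pi.single_eq_of_ne hkj, hc k hk])
    rw [lassoObjective_add_single] at h
    linarith
  set g : ℝ := inner ℝ (y j) (y i - ∑ k, c k • y k)
  have hup : g ≤ lam := by
    have : 0 ≤ 2 * lam - 2 * g := by
      refine nonneg_of_forall_quadratic_nonneg (a := ‖y j‖ ^ 2) fun t ht _ => ?_
      have h1 := key t
      have h2 := abs_add_le (c j) t
      rw [abs_of_pos ht] at h2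
      nlinarith
    linarith
  have hlow : -lam ≤ g := by
    have : 0 ≤ 2 * lam + 2 * g := by
      refine nonneg_of_forall_quadratic_nonneg (a := ‖y j‖ ^ 2) fun t ht _ => ?_
      have h1 := key (-t)
      have h2 := abs_add_le (c j) (-t)
      rw [abs_neg, abs_of_pos ht] at h2
      nlinarith
    linarith
  have hg : |g| ≤ lam := abs_le.2 ⟨hlow, hup⟩
  refine ⟨hg, le_antisymm ?_ ?_⟩
  · calc c j * g ≤ |c j * g| := le_abs_self _
      _ = |g| * |c j| := by rw [abs_mul, mul_comm]
      _ ≤ lam * |c j| := mul_le_mul_of_nonneg_right hg (abs_nonneg _)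
  -- Shrinking `c j` by the factor `1 - t` changes the penalty linearly in `t`, whatever the sign of
  -- `c j`.
  · have : 0 ≤ 2 * (c j * g) - 2 * (lam * |c j|) := by
      refine nonneg_of_forall_quadratic_nonneg (a := c j ^ 2 * ‖y j‖ ^ 2) fun t ht ht1 => ?_
      have h1 := key (-(t * c j))
      have h2 : |c j + -(t * c j)| = (1 - t) * |c j| := by
        rw [show c j + -(t * c j) = (1 - t) * c j by ring, abs_mul,
          abs_of_nonneg (sub_nonneg.2 ht1)]
      rw [h2] at h1
      linarith
    linarith

theorem continuous_lassoObjective {d N : ℕ} (lam : ℝ) (y : Fin N → Vec d) (i : Fin N) :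
    Continuous (lassoObjective lam y i) := by
  unfold lassoObjective
  fun_prop

/-- The Lasso with coefficients supported in `S` has a solution. -/
theorem exists_lasso_minimizer {d N : ℕ} {lam : ℝ} (hlam : 0 < lam) (y : Fin N → Vec d)
    (i : Fin N) (S : Set (Fin N)) :
    ∃ c : Fin N → ℝ, (∀ j, j ∉ S → c j = 0) ∧
      ∀ c' : Fin N → ℝ, (∀ j, j ∉ S → c' j = 0) →
        lassoObjective lam y i c ≤ lassoObjective lam y i c' := by
  -- The penalty alone confines every competitor at least as good as `0` to the ball of radius `R`;
  -- compactness does the rest.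
  set R : ℝ := lassoObjective lam y i 0 / (2 * lam)
  have h0 : 0 ≤ lassoObjective lam y i 0 := by
    unfold lassoObjective
    simp only [Pi.zero_apply, abs_zero, Finset.sum_const_zero, mul_zero, add_zero]
    positivity
  have hR : 0 ≤ R := by positivity
  have hclosed : IsClosed {c : Fin N → ℝ | ∀ j, j ∉ S → c j = 0} := by
    simp only [Set.ofPred_forall]
    exact isClosed_iInter fun j => isClosed_iInter fun _ =>
      isClosed_eq (continuous_apply j) continuous_const
  have hcomp : IsCompact (Metric.closedBall (0 : Fin N → ℝ) R ∩ {c | ∀ j, j ∉ S → c j = 0}) :=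
    (isCompact_closedBall 0 R).inter_right hclosed
  obtain ⟨c, hc, hmin⟩ := hcomp.exists_isMinOn ⟨0, by simp [hR]⟩
    (continuous_lassoObjective lam y i).continuousOn
  refine ⟨c, hc.2, fun c' hc' => ?_⟩
  by_cases hle : lassoObjective lam y i c' ≤ lassoObjective lam y i 0
  · refine hmin ⟨?_, hc'⟩
    rw [mem_closedBall_zero_iff, pi_norm_le_iff_of_nonneg hR]
    intro j
    have h1 : |c' j| ≤ ∑ k, |c' k| :=
      Finset.single_le_sum (f := fun k => |c' k|) (fun k _ => abs_nonneg _) (Finset.mem_univ j)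
    rw [Real.norm_eq_abs, le_div_iff₀ (by positivity)]
    have h2 : 2 * lam * ∑ k, |c' k| ≤ lassoObjective lam y i c' := by
      unfold lassoObjective
      nlinarith [sq_nonneg ‖y i - ∑ k, c' k • y k‖]
    nlinarith
  · push Not at hle
    exact (hmin ⟨by simp [hR], by simp⟩ : _ ≤ lassoObjective lam y i 0).trans hle.le

/-- A dual certificate: if the residual of `c₀` satisfies the optimality conditions, strictly
outside `S`, then all Lasso solutions are supported in `S`. -/
theorem lasso_support_subset {d N : ℕ} {lam : ℝ} {y : Fin N → Vec d} {i : Fin N}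
    {S : Set (Fin N)} {c₀ c : Fin N → ℝ}
    (hcompl : ∀ j, c₀ j * inner ℝ (y j) (y i - ∑ k, c₀ k • y k) = lam * |c₀ j|)
    (hS : ∀ j ∈ S, |inner ℝ (y j) (y i - ∑ k, c₀ k • y k)| ≤ lam)
    (hSc : ∀ j, j ∉ S → j ≠ i → |inner ℝ (y j) (y i - ∑ k, c₀ k • y k)| < lam)
    (hci : c i = 0) (hle : lassoObjective lam y i c ≤ lassoObjective lam y i c₀)
    {j : Fin N} (hj : c j ≠ 0) : j ∈ S := by
  set r : Vec d := y i - ∑ k, c₀ k • y k with hr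
  have h1 : y i - ∑ k, c k • y k = r + ∑ k, (c₀ k - c k) • y k := by
    simp only [hr, sub_smul, Finset.sum_sub_distrib]
    abel
  have h2 : inner ℝ r (∑ k, (c₀ k - c k) • y k)
      = lam * ∑ k, |c₀ k| - ∑ k, c k * inner ℝ (y k) r := by
    rw [inner_sum, Finset.mul_sum, ← Finset.sum_sub_distrib]
    refine Finset.sum_congr rfl fun k _ => ?_
    rw [real_inner_smul_right, real_inner_comm, sub_mul, hcompl k]
  have hterm : ∀ k, 0 ≤ lam * |c k| - c k * inner ℝ (y k) r := by
    intro k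
    by_cases hk : k = i
    · subst hk
      simp [hci]
    · have hb : |inner ℝ (y k) r| ≤ lam := by
        by_cases hkS : k ∈ S
        · exact hS k hkS
        · exact (hSc k hkS hk).le
      have : c k * inner ℝ (y k) r ≤ |inner ℝ (y k) r| * |c k| := by
        rw [← abs_mul, mul_comm]
        exact le_abs_self _
      nlinarith [abs_nonneg (c k)]
  -- By complementarity, the objective at `c` minus that at `c₀` is twice this sum plus a square.
  -- Nonnegative terms with sum at most zero all vanish.
  have hsum : ∑ k, (lam * |c k| - c k * inner ℝ (y k) r) ≤ 0 := by
    unfold lassoObjective at hle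
    rw [h1, ← hr, norm_add_sq_real, h2] at hle
    rw [Finset.sum_sub_distrib, ← Finset.mul_sum]
    nlinarith [sq_nonneg ‖∑ k, (c₀ k - c k) • y k‖]
  have hjz : lam * |c j| - c j * inner ℝ (y j) r ≤ 0 :=
    (Finset.single_le_sum (f := fun k => lam * |c k| - c k * inner ℝ (y k) r)
      (fun k _ => hterm k) (Finset.mem_univ j)).trans hsum
  by_contra hjS
  have hlt := hSc j hjS (fun h => hj (h ▸ hci))
  have : c j * inner ℝ (y j) r ≤ |inner ℝ (y j) r| * |c j| := by
    rw [← abs_mul, mul_comm]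
    exact le_abs_self _
  nlinarith [abs_pos.2 hj]

/-! ### Inradius, incoherence and dual directions -/

theorem abs_inner_le_of_mem_symmConvexHull {d : ℕ} {A : Set (Vec d)} {w q : Vec d} {M : ℝ}
    (hM : ∀ a ∈ A, |inner ℝ a w| ≤ M) (hq : q ∈ symmConvexHull A) : |inner ℝ q w| ≤ M := by
  have hconv : Convex ℝ {q : Vec d | |inner ℝ q w| ≤ M} := by
    intro u hu v hv s t hs ht hst
    simp only [Set.mem_ofPred_eq, abs_le] at hu hv ⊢
    rw [inner_add_left, real_inner_smul_left, real_inner_smul_left]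
    constructor <;> nlinarith
  refine convexHull_min ?_ hconv hq
  rintro a (ha | ha)
  · exact hM a ha
  · have := hM (-a) ha
    rwa [inner_neg_left, abs_neg] at this

/-- If the hull contains a ball of radius `R` in `U` with center `c`, it contains `c ± R w / ‖w‖`.
Subtracting the bounds at these two points eliminates the center. -/
theorem inradiusIn_mul_norm_le {d : ℕ} {U : Submodule ℝ (Vec d)} {A : Set (Vec d)} {w : Vec d}
    {M : ℝ} (hw : w ∈ U) (hM0 : 0 ≤ M) (hM : ∀ a ∈ A, |inner ℝ a w| ≤ M) :
    inradiusIn U (symmConvexHull A) * ‖w‖ ≤ M := by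
  rcases eq_or_ne w 0 with rfl | hw0
  · simpa using hM0
  have hwpos : 0 < ‖w‖ := norm_pos_iff.2 hw0
  by_contra hcon
  push Not at hcon
  rw [← div_lt_iff₀ hwpos] at hcon
  have hne : {R | 0 ≤ R ∧ ∃ c ∈ U, Metric.closedBall c R ∩ (U : Set (Vec d))
      ⊆ symmConvexHull A}.Nonempty := by
    by_contra hemp
    rw [Set.not_nonempty_iff_eq_empty] at hemp
    rw [inradiusIn, hemp, Real.sSup_empty] at hcon
    exact absurd hcon (not_lt.2 (by positivity))
  obtain ⟨R, ⟨hR0, c, hcU, hball⟩, hR⟩ := exists_lt_of_lt_csSup hne hcon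
  rw [div_lt_iff₀ hwpos] at hR
  have hnorm : ‖(R * ‖w‖⁻¹) • w‖ ≤ R := by
    rw [norm_smul, Real.norm_eq_abs, abs_of_nonneg (by positivity), mul_assoc,
      inv_mul_cancel₀ hwpos.ne', mul_one]
  have hplus : c + (R * ‖w‖⁻¹) • w ∈ symmConvexHull A :=
    hball ⟨by simpa [dist_eq_norm] using hnorm, U.add_mem hcU (U.smul_mem _ hw)⟩
  have hminus : c - (R * ‖w‖⁻¹) • w ∈ symmConvexHull A :=
    hball ⟨by simpa [dist_eq_norm] using hnorm, U.sub_mem hcU (U.smul_mem _ hw)⟩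
  have h1 := (abs_le.1 (abs_inner_le_of_mem_symmConvexHull hM hplus)).2
  have h2 := (abs_le.1 (abs_inner_le_of_mem_symmConvexHull hM hminus)).1
  have h3 : inner ℝ ((R * ‖w‖⁻¹) • w) w = R * ‖w‖ := by
    rw [real_inner_smul_left, real_inner_self_eq_norm_sq]
    field_simp
  rw [inner_add_left, h3] at h1
  rw [inner_sub_left, h3] at h2
  linarith

theorem clusterInradius_le {d N k : ℕ} (U : Fin k → Submodule ℝ (Vec d))
    (x : Fin N → Vec d) (z : Fin N → Fin k) (i : Fin N) :
    clusterInradius U x z (z i)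
      ≤ inradiusIn (U (z i)) (symmConvexHull (clusterWithout x z i)) :=
  ciInf_le (f := fun i' : {i' : Fin N // z i' = z i} =>
    inradiusIn (U (z i)) (symmConvexHull (clusterWithout x z i')))
    (Set.finite_range _).bddBelow ⟨i, rfl⟩

/-- The only way the inradius enters later: small correlations with the other cluster points force a
small norm. -/
theorem clusterInradius_mul_norm_le {d N k : ℕ} {U : Fin k → Submodule ℝ (Vec d)}
    {x : Fin N → Vec d} {z : Fin N → Fin k} {i : Fin N} {w : Vec d} {M : ℝ}
    (hw : w ∈ U (z i)) (hM0 : 0 ≤ M) (hM : ∀ j, j ≠ i → z j = z i → |inner ℝ (x j) w| ≤ M) :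
    clusterInradius U x z (z i) * ‖w‖ ≤ M := by
  refine (mul_le_mul_of_nonneg_right (clusterInradius_le U x z i) (norm_nonneg w)).trans
    (inradiusIn_mul_norm_le hw hM0 ?_)
  rintro a ⟨j, hji, hzj, rfl⟩
  exact hM j hji hzj

theorem subspaceIncoherence_nonneg {d N k : ℕ} (lam : ℝ) (U : Fin k → Submodule ℝ (Vec d))
    (x : Fin N → Vec d) (z : Fin N → Fin k) (ℓ : Fin k) :
    0 ≤ subspaceIncoherence lam U x z ℓ := by
  refine Real.sSup_nonneg ?_
  rintro t ⟨i, j, -, -, rfl⟩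
  exact abs_nonneg _

theorem abs_inner_le_subspaceIncoherence {d N k : ℕ} (lam : ℝ)
    (U : Fin k → Submodule ℝ (Vec d)) (x : Fin N → Vec d) {z : Fin N → Fin k} {i j : Fin N}
    (hij : z j ≠ z i) :
    |inner ℝ (normalizedDualDirection lam U x z i) (x j)|
      ≤ subspaceIncoherence lam U x z (z i) := by
  refine le_csSup (Set.Finite.bddAbove ?_) ⟨i, j, rfl, hij, rfl⟩
  refine (Set.finite_range fun q : Fin N × Fin N =>
    |inner ℝ (normalizedDualDirection lam U x z q.1) (x q.2)|).subset ?_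
  rintro t ⟨i', j', -, -, rfl⟩
  exact ⟨(i', j'), rfl⟩

/-- The dual direction of a point, projected onto the subspace of its cluster. -/
noncomputable def projectedDualDirection {d N k : ℕ} (lam : ℝ) (U : Fin k → Submodule ℝ (Vec d))
    (x : Fin N → Vec d) (z : Fin N → Fin k) (i : Fin N) : Vec d :=
  (U (z i)).starProjection (dualDirection lam (x i) (clusterWithout x z i))

theorem abs_inner_projectedDualDirection_le {d N k : ℕ} (lam : ℝ)
    (U : Fin k → Submodule ℝ (Vec d)) (x : Fin N → Vec d) {z : Fin N → Fin k} {i j : Fin N}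
    (hij : z j ≠ z i) :
    |inner ℝ (x j) (projectedDualDirection lam U x z i)|
      ≤ subspaceIncoherence lam U x z (z i) * ‖projectedDualDirection lam U x z i‖ := by
  have h := abs_inner_le_subspaceIncoherence lam U x hij
  change |inner ℝ (‖projectedDualDirection lam U x z i‖⁻¹ • projectedDualDirection lam U x z i)
    (x j)| ≤ _ at h
  set ν := projectedDualDirection lam U x z i
  rcases eq_or_ne ν 0 with h0 | h0
  · simp [h0]
  have hpos : 0 < ‖ν‖ := norm_pos_iff.2 h0
  rw [real_inner_smul_left, abs_mul, abs_of_pos (inv_pos.2 hpos), real_inner_comm,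
    inv_mul_le_iff₀ hpos] at h
  linarith

theorem inner_starProjection_of_mem {d : ℕ} {U : Submodule ℝ (Vec d)} {a : Vec d} (ha : a ∈ U)
    (ν : Vec d) : inner ℝ a (U.starProjection ν) = inner ℝ a ν := by
  rw [← Submodule.inner_starProjection_left_eq_right,
    Submodule.starProjection_eq_self_iff.2 ha]

/-- Projecting onto `U` keeps the inner products with `x` and `A` and does not increase the norm.
The vector in the definition of the incoherence is thus itself a dual solution. -/
theorem IsDualDirection.starProjection {d : ℕ} {lam : ℝ} (hlam : 0 < lam)
    {U : Submodule ℝ (Vec d)} {x : Vec d} {A : Set (Vec d)} (hx : x ∈ U) (hA : ∀ a ∈ A, a ∈ U)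
    {ν : Vec d} (hν : IsDualDirection lam x A ν) :
    IsDualDirection lam x A (U.starProjection ν) := by
  refine ⟨fun a ha => ?_, fun ν' hν' => (hν.2 ν' hν').trans ?_⟩
  · rw [inner_starProjection_of_mem (hA a ha)]
    exact hν.1 a ha
  · have h := pow_le_pow_left₀ (norm_nonneg _) (U.norm_starProjection_apply_le ν) 2
    rw [dualObjective, dualObjective, inner_starProjection_of_mem hx]
    nlinarith

theorem isDualDirection_projectedDualDirection {d N k : ℕ} {lam : ℝ} (hlam : 0 < lam)
    {U : Fin k → Submodule ℝ (Vec d)} {x : Fin N → Vec d} {z : Fin N → Fin k}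
    (hx : ∀ i, x i ∈ U (z i)) (i : Fin N) :
    IsDualDirection lam (x i) (clusterWithout x z i) (projectedDualDirection lam U x z i) := by
  refine (isDualDirection_dualDirection hlam (x i) _).starProjection hlam (hx i) ?_
  rintro a ⟨j, -, hzj, rfl⟩
  exact hzj ▸ hx j

/-- The variational inequality for the dual direction. -/
theorem IsDualDirection.inner_le_zero {d : ℕ} {lam : ℝ} {x : Vec d} {A : Set (Vec d)}
    {ν u : Vec d} (hν : IsDualDirection lam x A ν) (hu : DualFeasible A u) :
    inner ℝ (x - lam • ν) (u - ν) ≤ 0 := by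
  have key : 0 ≤ -inner ℝ (x - lam • ν) (u - ν) := by
    refine nonneg_of_forall_quadratic_nonneg (a := lam / 2 * ‖u - ν‖ ^ 2) fun t ht ht1 => ?_
    have hfeas : DualFeasible A (ν + t • (u - ν)) := by
      have h := convex_dualFeasible A hν.1 hu (sub_nonneg.2 ht1) ht.le (by ring)
      have e : (1 - t) • ν + t • u = ν + t • (u - ν) := by module
      rwa [e] at h
    have h := hν.2 _ hfeas
    rw [dualObjective, dualObjective, norm_add_sq_real, inner_add_right, real_inner_smul_right,
      real_inner_smul_right, norm_smul, mul_pow, Real.norm_eq_abs, sq_abs] at h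
    rw [inner_sub_left, real_inner_smul_left]
    linarith
  linarith

/-! ### Perturbation by the compression -/

/-- By homogeneity, the arithmetic mean of the squared norms in the error bound may be replaced
by the product of the norms. -/
theorem abs_inner_sub_inner_map_le {E F : Type*} [NormedAddCommGroup E] [InnerProductSpace ℝ E]
    [NormedAddCommGroup F] [InnerProductSpace ℝ F] (T : E →ₗ[ℝ] F) {U V : Submodule ℝ E} {ε : ℝ}
    (h : ∀ u ∈ U, ∀ v ∈ V, |inner ℝ u v - inner ℝ (T u) (T v)| ≤ ε * ((‖u‖ ^ 2 + ‖v‖ ^ 2) / 2))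
    {u v : E} (hu : u ∈ U) (hv : v ∈ V) :
    |inner ℝ u v - inner ℝ (T u) (T v)| ≤ ε * (‖u‖ * ‖v‖) := by
  rcases eq_or_ne u 0 with rfl | hu0
  · simp
  rcases eq_or_ne v 0 with rfl | hv0
  · simp
  have hup : 0 < ‖u‖ := norm_pos_iff.2 hu0
  have hvp : 0 < ‖v‖ := norm_pos_iff.2 hv0
  -- On unit vectors the two forms of the bound agree.
  have h1 := h _ (U.smul_mem ‖u‖⁻¹ hu) _ (V.smul_mem ‖v‖⁻¹ hv)
  simp only [map_smul, real_inner_smul_left, real_inner_smul_right, norm_smul, norm_inv,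
    norm_norm, inv_mul_cancel₀ hup.ne', inv_mul_cancel₀ hvp.ne'] at h1
  rw [← mul_sub, ← mul_sub, abs_mul, abs_mul, abs_of_pos (inv_pos.2 hup),
    abs_of_pos (inv_pos.2 hvp), inv_mul_le_iff₀ hvp, inv_mul_le_iff₀ hup] at h1
  linarith

/-- `|q - 1| ≤ |q - 1| * (q + 1) = |q ^ 2 - 1|`. -/
theorem abs_sub_one_le_of_sq {q ε : ℝ} (hq : 0 ≤ q) (h1 : 1 - ε ≤ q ^ 2) (h2 : q ^ 2 ≤ 1 + ε) :
    |q - 1| ≤ ε := by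
  rw [abs_le]
  constructor
  · by_contra hcon
    push Not at hcon
    nlinarith
  · by_contra hcon
    push Not at hcon
    nlinarith

/-- Normalizing a vector whose norm is nearly preserved changes inner products by little. -/
theorem abs_inv_mul_sub_le {q ε b a m : ℝ} (hε : ε ≤ 1 / 2) (hq : |q - 1| ≤ ε)
    (hab : |a - b| ≤ ε * m) (ha : |a| ≤ m) : |q⁻¹ * b - a| ≤ 4 * ε * m := by
  have hq2 := abs_le.1 hq
  have hqpos : 1 / 2 ≤ q := by linarith
  have hε0 : 0 ≤ ε := (abs_nonneg _).trans hq
  have hm : 0 ≤ m := (abs_nonneg _).trans ha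
  -- Both error terms are at most `ε * m`, and `q⁻¹ ≤ 2`; hence the factor 4.
  have e : q⁻¹ * b - a = q⁻¹ * ((b - a) - (q - 1) * a) := by
    field_simp
    ring
  rw [e, abs_mul, abs_of_pos (by positivity), inv_mul_le_iff₀ (by linarith)]
  calc |b - a - (q - 1) * a| ≤ |b - a| + |(q - 1) * a| := abs_sub _ _
    _ ≤ ε * m + ε * m := by
      rw [abs_sub_comm b a, abs_mul]
      gcongr
    _ ≤ q * (4 * ε * m) := by nlinarith [mul_nonneg hε0 hm]

/-- Stability of the solution of the dual problem: `ν` satisfies the variational inequality of the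
original problem against `s • w`, and `w` satisfies it approximately against `s • ν`. -/
theorem dual_stability {E : Type*} [NormedAddCommGroup E] [InnerProductSpace ℝ E]
    {x ν w : E} {lam ε ρ s : ℝ} (hlam : 0 < lam) (hε : 0 ≤ ε) (hρ : 0 < ρ) (hρ1 : ρ ≤ 1)
    (hlamρ : lam ≤ ρ / 2) (hx : ‖x‖ = 1) (hν : ‖ν‖ ≤ 1 / ρ) (hw : ‖w‖ ≤ 2 / ρ)
    (hs0 : 0 ≤ s) (hs1 : s ≤ 1) (hs : 1 - s ≤ 8 * ε / ρ)
    (h1 : inner ℝ (x - lam • ν) (s • w - ν) ≤ 0)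
    (h2 : inner ℝ (x - lam • w) (s • ν - w) ≤ (4 * ε + lam * (ε * ‖w‖)) * ‖s • ν - w‖) :
    ‖w - ν‖ ^ 2 ≤ 64 * ε / (lam * ρ ^ 2) := by
  obtain ⟨P, hP⟩ : ∃ P, P = 1 / ρ := ⟨_, rfl⟩
  have hρP : ρ * P = 1 := by rw [hP]; field_simp
  have hP0 : 0 < P := by rw [hP]; positivity
  have hP1 : 1 ≤ P := by nlinarith
  replace hν : ‖ν‖ ≤ P := hP ▸ hν
  replace hw : ‖w‖ ≤ 2 * P := hw.trans_eq (by rw [hP]; ring)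
  replace hs : 1 - s ≤ 8 * ε * P := hs.trans_eq (by rw [hP]; ring)
  have hlamP : lam * P ≤ 1 / 2 := by nlinarith
  have hxw : inner ℝ x w ≤ 2 * P := by
    have := real_inner_le_norm x w
    rw [hx, one_mul] at this
    exact this.trans hw
  have hxν : inner ℝ x ν ≤ P := by
    have := real_inner_le_norm x ν
    rw [hx, one_mul] at this
    exact this.trans hν
  have hνw : -inner ℝ ν w ≤ 2 * P * P := by
    have h3 := neg_le_of_abs_le (abs_real_inner_le_norm ν w)
    have h4 : ‖ν‖ * ‖w‖ ≤ P * (2 * P) := by gcongr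
    linarith
  have hlamνw : 2 * lam * -inner ℝ ν w ≤ 2 * P := by
    calc 2 * lam * -inner ℝ ν w ≤ 2 * lam * (2 * P * P) := by gcongr
      _ = 4 * P * (lam * P) := by ring
      _ ≤ 4 * P * (1 / 2) := by gcongr
      _ = 2 * P := by ring
  have hdist : ‖s • ν - w‖ ≤ 3 * P := by
    have h3 : ‖s • ν‖ ≤ P := by
      rw [norm_smul, Real.norm_eq_abs, abs_of_nonneg hs0]
      nlinarith [norm_nonneg ν]
    linarith [norm_sub_le (s • ν) w]
  have hE : (4 * ε + lam * (ε * ‖w‖)) * ‖s • ν - w‖ ≤ 15 * ε * P * P := by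
    have h3 : lam * (ε * ‖w‖) ≤ ε := by
      calc lam * (ε * ‖w‖) ≤ lam * (ε * (2 * P)) := by gcongr
        _ = 2 * ε * (lam * P) := by ring
        _ ≤ 2 * ε * (1 / 2) := by gcongr
        _ = ε := by ring
    calc (4 * ε + lam * (ε * ‖w‖)) * ‖s • ν - w‖ ≤ (4 * ε + ε) * (3 * P) := by gcongr
      _ = 15 * ε * P * 1 := by ring
      _ ≤ 15 * ε * P * P := by gcongr
  have hscale : (1 - s) * (inner ℝ x w + inner ℝ x ν + 2 * lam * -inner ℝ ν w)
      ≤ 40 * ε * P * P := by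
    calc (1 - s) * (inner ℝ x w + inner ℝ x ν + 2 * lam * -inner ℝ ν w)
        ≤ (1 - s) * (5 * P) := by
          refine mul_le_mul_of_nonneg_left ?_ (sub_nonneg.2 hs1)
          linarith
      _ ≤ 8 * ε * P * (5 * P) := by gcongr
      _ = 40 * ε * P * P := by ring
  -- The sum of `h1` and `h2` bounds `lam * ‖w - ν‖ ^ 2` by the left sides of `hE` and `hscale`; 55
  -- = 15 + 40.
  have hmain : lam * ‖w - ν‖ ^ 2 ≤ 55 * ε * P * P := by
    rw [norm_sub_sq_real, real_inner_comm]
    simp only [inner_sub_left, inner_sub_right, real_inner_smul_left, real_inner_smul_right,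
      real_inner_self_eq_norm_sq] at h1 h2
    rw [real_inner_comm ν w] at h2
    linarith
  have hPP : 0 ≤ ε * P * P := by positivity
  have e : 64 * ε / (lam * ρ ^ 2) = 64 * ε * P * P / lam := by
    rw [hP]
    field_simp
  rw [e, le_div_iff₀ hlam]
  linarith

/-! ### Detection after compression -/

section

variable {d p N k : ℕ} {U : Fin k → Submodule ℝ (Vec d)} {x : Fin N → Vec d}
  {z : Fin N → Fin k} {Ψ : Matrix (Fin p) (Fin d) ℝ} {lam ε : ℝ}

theorem PreservesGeometry.abs_norm_sub_one_le (hΨ : PreservesGeometry Ψ U x ε)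
    (hx1 : ∀ i, ‖x i‖ = 1) (i : Fin N) : |‖project Ψ (x i)‖ - 1| ≤ ε := by
  have h := hΨ.2 i
  rw [hx1 i, one_pow, mul_one, mul_one] at h
  exact abs_sub_one_le_of_sq (norm_nonneg _) h.1 h.2

theorem PreservesGeometry.abs_inner_sub_le (hΨ : PreservesGeometry Ψ U x ε) {ℓ ℓ' : Fin k}
    {u v : Vec d} (hu : u ∈ U ℓ) (hv : v ∈ U ℓ') :
    |inner ℝ u v - inner ℝ (project Ψ u) (project Ψ v)| ≤ ε * (‖u‖ * ‖v‖) :=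
  abs_inner_sub_inner_map_le (Matrix.toEuclideanLin Ψ)
    (fun u hu v hv => hΨ.1 ℓ ℓ' u (Or.inl hu) v (Or.inr hv)) hu hv

/-- Only the data point is normalized, not `u`, and `U ℓ` need not be the subspace of its cluster.
-/
theorem PreservesGeometry.abs_inner_compressedData_sub_le (hΨ : PreservesGeometry Ψ U x ε)
    (hxU : ∀ i, x i ∈ U (z i)) (hx1 : ∀ i, ‖x i‖ = 1) (hε : ε ≤ 1 / 2) (j : Fin N)
    {ℓ : Fin k} {u : Vec d} (hu : u ∈ U ℓ) :
    |inner ℝ (compressedData Ψ x j) (project Ψ u) - inner ℝ (x j) u| ≤ 4 * ε * ‖u‖ := by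
  have h1 := hΨ.abs_inner_sub_le (hxU j) hu
  have h2 := abs_real_inner_le_norm (x j) u
  rw [hx1 j, one_mul] at h1 h2
  rw [compressedData, real_inner_smul_left]
  exact abs_inv_mul_sub_le hε (hΨ.abs_norm_sub_one_le hx1 j) h1 h2

/-- A solution `w` of the compressed dual problem of `x i`, given by its variational inequality,
is strictly feasible for the points of the other clusters. -/
theorem compressed_dual_strictly_feasible (hxU : ∀ i, x i ∈ U (z i)) (hx1 : ∀ i, ‖x i‖ = 1)
    (hΨ : PreservesGeometry Ψ U x ε) (hlam : 0 < lam) (hε0 : 0 ≤ ε) {i : Fin N}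
    (hlamρ : lam < clusterInradius U x z (z i) / 2) (hρ1 : clusterInradius U x z (z i) ≤ 1)
    (hμρ : subspaceIncoherence lam U x z (z i) < clusterInradius U x z (z i))
    (hε : ε ≤ (clusterInradius U x z (z i) - subspaceIncoherence lam U x z (z i)) ^ 2
      * lam / 1024)
    {w : Vec d} (hwU : w ∈ U (z i))
    (hfeas : ∀ j, j ≠ i → z j = z i →
      |inner ℝ (compressedData Ψ x j) (project Ψ w)| ≤ 1)
    (hopt : ∀ u ∈ U (z i), (∀ j, j ≠ i → z j = z i →
        |inner ℝ (compressedData Ψ x j) (project Ψ u)| ≤ 1) →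
      inner ℝ (compressedData Ψ x i - lam • project Ψ w) (project Ψ u - project Ψ w) ≤ 0)
    {j : Fin N} (hj : z j ≠ z i) :
    |inner ℝ (compressedData Ψ x j) (project Ψ w)| < 1 := by
  have hμ0 := subspaceIncoherence_nonneg lam U x z (z i)
  have hradius := fun (u : Vec d) (M : ℝ) =>
    clusterInradius_mul_norm_le (U := U) (x := x) (z := z) (i := i) (w := u) (M := M)
  have hincoh := abs_inner_projectedDualDirection_le lam U x hj
  have hνdual := isDualDirection_projectedDualDirection hlam hxU i
  have hνU : projectedDualDirection lam U x z i ∈ U (z i) :=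
    Submodule.starProjection_apply_mem _ _
  set ρ := clusterInradius U x z (z i)
  set μ := subspaceIncoherence lam U x z (z i)
  set ν := projectedDualDirection lam U x z i
  have hρ0 : 0 < ρ := by linarith
  have hΔ : 0 < ρ - μ := sub_pos.2 hμρ
  have hΔ2 : (ρ - μ) ^ 2 ≤ ρ - μ := by nlinarith
  have hεlam : 1024 * ε ≤ lam := by nlinarith
  have hεΔ : 1024 * ε ≤ ρ - μ := by nlinarith
  have hεhalf : ε ≤ 1 / 2 := by linarith
  have hclose : ∀ l : Fin N, ∀ u ∈ U (z i),
      |inner ℝ (compressedData Ψ x l) (project Ψ u) - inner ℝ (x l) u| ≤ 4 * ε * ‖u‖ :=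
    fun l u hu => hΨ.abs_inner_compressedData_sub_le hxU hx1 hεhalf l hu
  have hνfeas : ∀ l, l ≠ i → z l = z i → |inner ℝ (x l) ν| ≤ 1 :=
    fun l hl hzl => hνdual.1 _ ⟨l, hl, hzl, rfl⟩
  have hν : ‖ν‖ ≤ 1 / ρ := by
    rw [le_div_iff₀ hρ0, mul_comm]
    exact hradius ν 1 hνU zero_le_one hνfeas
  have hwfeas : ∀ l, l ≠ i → z l = z i → |inner ℝ (x l) w| ≤ 1 + 4 * ε * ‖w‖ := by
    intro l hl hzl
    have h1 := abs_le.1 (hclose l w hwU)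
    have h2 := abs_le.1 (hfeas l hl hzl)
    exact abs_le.2 ⟨by linarith, by linarith⟩
  -- The inradius gives `ρ * ‖w‖ ≤ 1 + 4 * ε * ‖w‖`; the last term is at most half the left side.
  have hw : ‖w‖ ≤ 2 / ρ := by
    have h1 := hradius w _ hwU (by positivity) hwfeas
    rw [le_div_iff₀ hρ0]
    nlinarith [norm_nonneg w]
  have hεw : 4 * ε * ‖w‖ ≤ 8 * ε / ρ := by
    calc 4 * ε * ‖w‖ ≤ 4 * ε * (2 / ρ) := by gcongr
      _ = 8 * ε / ρ := by ring
  have hεν : 4 * ε * ‖ν‖ ≤ 8 * ε / ρ := by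
    calc 4 * ε * ‖ν‖ ≤ 4 * ε * (2 / ρ) := by
          gcongr
          exact hν.trans (by gcongr; norm_num)
      _ = 8 * ε / ρ := by ring
  -- `w` and `ν` each violate the constraints of the other's problem by at most the factor `1 + 8 *
  -- ε / ρ`; `s` is its inverse.
  obtain ⟨s, hsdef⟩ : ∃ s, s = ρ / (ρ + 8 * ε) := ⟨_, rfl⟩
  have hs0 : 0 ≤ s := by rw [hsdef]; positivity
  have hsmul : s * (1 + 8 * ε / ρ) = 1 := by
    rw [hsdef]
    field_simp
  have hερ : 0 ≤ 8 * ε / ρ := by positivity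
  have hs1 : s ≤ 1 := by nlinarith
  have hs : 1 - s ≤ 8 * ε / ρ := by nlinarith
  have hswfeas : DualFeasible (clusterWithout x z i) (s • w) := by
    rintro a ⟨l, hl, hzl, rfl⟩
    rw [real_inner_smul_right, abs_mul, abs_of_nonneg hs0, ← hsmul]
    gcongr
    linarith [hwfeas l hl hzl]
  have hsνfeas : ∀ l, l ≠ i → z l = z i →
      |inner ℝ (compressedData Ψ x l) (project Ψ (s • ν))| ≤ 1 := by
    intro l hl hzl
    have h1 := abs_le.1 (hclose l ν hνU)
    have h2 := abs_le.1 (hνfeas l hl hzl)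
    rw [project, map_smul, real_inner_smul_right, abs_mul, abs_of_nonneg hs0, ← hsmul]
    refine mul_le_mul_of_nonneg_left ?_ hs0
    change |inner ℝ (compressedData Ψ x l) (project Ψ ν)| ≤ _
    exact abs_le.2 ⟨by linarith, by linarith⟩
  have h1 := hνdual.inner_le_zero hswfeas
  -- Undoing the compression in `hopt` costs `4 * ε` for the data term and `lam * (ε * ‖w‖)` for the
  -- quadratic term.
  have h2 : inner ℝ (x i - lam • w) (s • ν - w)
      ≤ (4 * ε + lam * (ε * ‖w‖)) * ‖s • ν - w‖ := by
    have hsνU := (U (z i)).smul_mem s hνU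
    have hu := (U (z i)).sub_mem hsνU hwU
    have h3 := hopt _ hsνU hsνfeas
    have e : project Ψ (s • ν) - project Ψ w = project Ψ (s • ν - w) := by simp [project]
    rw [e, inner_sub_left, real_inner_smul_left] at h3
    have h4 := (abs_le.1 (hclose i _ hu)).1
    have h5 := (abs_le.1 (hΨ.abs_inner_sub_le hwU hu)).1
    rw [inner_sub_left, real_inner_smul_left]
    nlinarith
  have hdist2 := dual_stability hlam hε0 hρ0 hρ1 hlamρ.le (hx1 i) hν hw hs0 hs1 hs h1 h2
  -- The constant 1024 is `64 * 4 ^ 2`: it makes the stability error a quarter of the relative gap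
  -- `(ρ - μ) / ρ`.
  have hdist : ‖w - ν‖ ≤ (ρ - μ) / (4 * ρ) := by
    refine (pow_le_pow_iff_left₀ (norm_nonneg _) (by positivity) two_ne_zero).1 ?_
    refine hdist2.trans ?_
    rw [div_pow, div_le_div_iff₀ (by positivity) (by positivity)]
    have h3 : 0 < ρ ^ 2 := by positivity
    calc 64 * ε * (4 * ρ) ^ 2 = 1024 * ρ ^ 2 * ε := by ring
      _ ≤ 1024 * ρ ^ 2 * ((ρ - μ) ^ 2 * lam / 1024) := by gcongr
      _ = (ρ - μ) ^ 2 * (lam * ρ ^ 2) := by ring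
  have hxjw : |inner ℝ (x j) w| ≤ μ * (1 / ρ) + (ρ - μ) / (4 * ρ) := by
    have h3 : inner ℝ (x j) w = inner ℝ (x j) ν + inner ℝ (x j) (w - ν) := by
      rw [inner_sub_right]
      ring
    have h4 := abs_real_inner_le_norm (x j) (w - ν)
    rw [hx1 j, one_mul] at h4
    rw [h3]
    calc _ ≤ |inner ℝ (x j) ν| + |inner ℝ (x j) (w - ν)| := abs_add_le _ _
      _ ≤ _ := add_le_add (hincoh.trans (by gcongr)) (h4.trans hdist)
  have hfin : |inner ℝ (compressedData Ψ x j) (project Ψ w)|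
      ≤ μ * (1 / ρ) + (ρ - μ) / (4 * ρ) + 8 * ε / ρ := by
    have h3 := abs_le.1 (hclose j w hwU)
    have h4 := abs_le.1 hxjw
    exact abs_le.2 ⟨by linarith, by linarith⟩
  refine hfin.trans_lt ?_
  have e : μ * (1 / ρ) + (ρ - μ) / (4 * ρ) + 8 * ε / ρ = (μ + (ρ - μ) / 4 + 8 * ε) / ρ := by
    field_simp
  rw [e, div_lt_one hρ0]
  linarith

/-- No Lasso solution on the compressed data uses points of other clusters. -/
theorem lasso_compressedData_support (hxU : ∀ i, x i ∈ U (z i)) (hx1 : ∀ i, ‖x i‖ = 1)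
    (hΨ : PreservesGeometry Ψ U x ε) (hlam : 0 < lam) (hε0 : 0 ≤ ε) {i : Fin N}
    (hlamρ : lam < clusterInradius U x z (z i) / 2) (hρ1 : clusterInradius U x z (z i) ≤ 1)
    (hμρ : subspaceIncoherence lam U x z (z i) < clusterInradius U x z (z i))
    (hε : ε ≤ (clusterInradius U x z (z i) - subspaceIncoherence lam U x z (z i)) ^ 2
      * lam / 1024)
    {c : Fin N → ℝ} (hci : c i = 0)
    (hmin : ∀ c' : Fin N → ℝ, c' i = 0 →
      lassoObjective lam (compressedData Ψ x) i c
        ≤ lassoObjective lam (compressedData Ψ x) i c')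
    {j : Fin N} (hj : c j ≠ 0) : z i = z j := by
  set y := compressedData Ψ x with hy
  obtain ⟨c₀, hc₀, hmin₀⟩ := exists_lasso_minimizer hlam y i {j | j ≠ i ∧ z j = z i}
  have hkkt := fun {l : Fin N} (hl : l ∈ {j | j ≠ i ∧ z j = z i}) =>
    lasso_optimality hc₀ hmin₀ hlam hl
  -- The same combination of uncompressed points lifts the scaled residual; it lies in `U (z i)`
  -- because `c₀` is supported on the cluster.
  obtain ⟨w, hwdef⟩ : ∃ w, w = lam⁻¹ • (‖project Ψ (x i)‖⁻¹ • x i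
    - ∑ l, c₀ l • (‖project Ψ (x l)‖⁻¹ • x l)) := ⟨_, rfl⟩
  have hwU : w ∈ U (z i) := by
    rw [hwdef]
    refine Submodule.smul_mem _ _ (Submodule.sub_mem _ (Submodule.smul_mem _ _ (hxU i))
      (Submodule.sum_mem _ fun l _ => ?_))
    by_cases hl : l ∈ {j | j ≠ i ∧ z j = z i}
    · exact Submodule.smul_mem _ _ (Submodule.smul_mem _ _ (hl.2 ▸ hxU l))
    · simp [hc₀ l hl]
  have hres : y i - ∑ l, c₀ l • y l = lam • project Ψ w := by
    rw [hwdef]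
    simp only [hy, compressedData, project, map_smul, map_sub, map_sum]
    rw [smul_inv_smul₀ hlam.ne']
  rw [hres] at hkkt
  simp only [real_inner_smul_right] at hkkt
  have hfeas : ∀ l, l ≠ i → z l = z i → |inner ℝ (y l) (project Ψ w)| ≤ 1 := by
    intro l hl hzl
    have h := (hkkt ⟨hl, hzl⟩).1
    rw [abs_mul, abs_of_pos hlam] at h
    exact le_of_mul_le_mul_left (by linarith) hlam
  have hcompl : ∀ l, c₀ l * inner ℝ (y l) (project Ψ w) = |c₀ l| := by
    intro l
    by_cases hl : l ∈ {j | j ≠ i ∧ z j = z i}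
    · have h := (hkkt hl).2
      exact mul_left_cancel₀ hlam.ne' (by linarith)
    · simp [hc₀ l hl]
  -- Here `y i - lam • project Ψ w` is `∑ l, c₀ l • y l`, which pairs with `project Ψ w` to `∑ l,
  -- |c₀ l|` and with any feasible vector to at most that.
  have hopt : ∀ u ∈ U (z i), (∀ l, l ≠ i → z l = z i → |inner ℝ (y l) (project Ψ u)| ≤ 1) →
      inner ℝ (y i - lam • project Ψ w) (project Ψ u - project Ψ w) ≤ 0 := by
    intro u _ hu
    rw [← hres, sub_sub_cancel, sum_inner]
    refine Finset.sum_nonpos fun l _ => ?_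
    rw [real_inner_smul_left, inner_sub_right, mul_sub, hcompl l, sub_nonpos]
    by_cases hl : l ∈ {j | j ≠ i ∧ z j = z i}
    · calc c₀ l * inner ℝ (y l) (project Ψ u) ≤ |c₀ l| * |inner ℝ (y l) (project Ψ u)| := by
            rw [← abs_mul]
            exact le_abs_self _
        _ ≤ |c₀ l| * 1 := by
            gcongr
            exact hu l hl.1 hl.2
        _ = |c₀ l| := mul_one _
    · simp [hc₀ l hl]
  have hmem : j ∈ {j | j ≠ i ∧ z j = z i} := by
    refine lasso_support_subset (c₀ := c₀) (fun l => ?_) (fun l hl => ?_) (fun l hl hli => ?_)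
      hci (hmin c₀ (hc₀ i fun h => h.1 rfl)) hj
    · rw [hres, real_inner_smul_right, ← hcompl l]
      ring
    · rw [hres, real_inner_smul_right]
      exact (hkkt hl).1
    · have hzl : z l ≠ z i := fun h => hl ⟨hli, h⟩
      have h := compressed_dual_strictly_feasible hxU hx1 hΨ hlam hε0 hlamρ hρ1 hμρ hε hwU
        hfeas hopt hzl
      rw [hres, real_inner_smul_right, abs_mul, abs_of_pos hlam]
      exact mul_lt_of_lt_one_right hlam h
  exact hmem.2.symm

/-- The zero vector does not solve the Lasso problems on the compressed data. -/
theorem lasso_compressedData_ne_zero (hxU : ∀ i, x i ∈ U (z i)) (hx1 : ∀ i, ‖x i‖ = 1)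
    (hΨ : PreservesGeometry Ψ U x ε) (hlam : 0 < lam) {i : Fin N}
    (hlamρ : lam < clusterInradius U x z (z i) / 2) (hlam1 : lam ≤ 1 / 2)
    (hε : 1024 * ε ≤ lam) {c : Fin N → ℝ}
    (hmin : ∀ c' : Fin N → ℝ, c' i = 0 →
      lassoObjective lam (compressedData Ψ x) i c
        ≤ lassoObjective lam (compressedData Ψ x) i c') : c ≠ 0 := by
  rintro rfl
  have hq := abs_le.1 (hΨ.abs_norm_sub_one_le hx1 i)
  have hε0 : 0 ≤ ε := (abs_nonneg _).trans (hΨ.abs_norm_sub_one_le hx1 i)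
  have hqpos : 0 < ‖project Ψ (x i)‖ := by linarith
  obtain ⟨u, hu⟩ : ∃ u, u = ‖project Ψ (x i)‖⁻¹ • x i := ⟨_, rfl⟩
  have huU : u ∈ U (z i) := hu ▸ Submodule.smul_mem _ _ (hxU i)
  have hΨu : project Ψ u = compressedData Ψ x i := by
    rw [hu]
    simp [project, compressedData]
  have hunorm : ‖u‖ * ‖project Ψ (x i)‖ = 1 := by
    rw [hu, norm_smul, hx1 i, norm_inv, norm_norm, mul_one, inv_mul_cancel₀ hqpos.ne']
  have hcorr : ∀ j, j ≠ i → z j = z i → |inner ℝ (x j) u| ≤ lam + 4 * ε * ‖u‖ := by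
    intro j hji _
    -- At `c = 0` the residual is `compressedData Ψ x i` itself, so its correlations are at most
    -- `lam`.
    have h1 := (lasso_optimality (lam := lam) (y := compressedData Ψ x) (i := i) (S := {j | j ≠ i})
      (c := 0) (fun _ _ => rfl) (fun c' hc' => hmin c' (hc' i fun h => h rfl)) hlam hji).1
    simp only [Pi.zero_apply, zero_smul, Finset.sum_const_zero, sub_zero] at h1
    have h2 := hΨ.abs_inner_compressedData_sub_le hxU hx1 (by linarith) j huU
    rw [hΨu] at h2
    have h3 := abs_le.1 h1
    have h4 := abs_le.1 h2
    exact abs_le.2 ⟨by linarith, by linarith⟩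
  have hr := clusterInradius_mul_norm_le huU (by positivity) hcorr
  have hupos : 0 ≤ ‖u‖ := norm_nonneg u
  have hlow : 2 * lam * ‖u‖ ≤ lam + 4 * ε * ‖u‖ :=
    (mul_le_mul_of_nonneg_right (by linarith) hupos).trans hr
  -- Since `4 * ε` is tiny against `lam`, `hlow` makes `‖u‖` barely exceed 1/2 at most, against this
  -- bound.
  have h5 : 2 / 3 ≤ ‖u‖ := by nlinarith
  nlinarith

/-- The unit vector `x i` has correlations at most 1 with the unit vectors of its cluster. -/
theorem clusterInradius_le_one (hxU : ∀ i, x i ∈ U (z i)) (hx1 : ∀ i, ‖x i‖ = 1) (i : Fin N) :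
    clusterInradius U x z (z i) ≤ 1 := by
  have h := clusterInradius_mul_norm_le (x := x) (z := z) (hxU i) zero_le_one fun j _ _ => by
    have := abs_real_inner_le_norm (x j) (x i)
    rwa [hx1, hx1, one_mul] at this
  rwa [hx1, mul_one] at h

end

end CompressedSSC

theorem mainTheorem1 :
    ∃ K : ℝ, 0 < K ∧
      ∀ (d p N k : ℕ) (U : Fin k → Submodule ℝ (CompressedSSC.Vec d))
        (x : Fin N → CompressedSSC.Vec d) (z : Fin N → Fin k)
        (Ψ : Matrix (Fin p) (Fin d) ℝ) (lam ε : ℝ),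
        (∀ i, x i ∈ U (z i)) →
        (∀ i, ‖x i‖ = 1) →
        (∀ ℓ, CompressedSSC.subspaceIncoherence lam U x z ℓ
          < CompressedSSC.clusterInradius U x z ℓ) →
        0 < lam →
        lam < (⨅ ℓ, CompressedSSC.clusterInradius U x z ℓ) / 2 →
        CompressedSSC.PreservesGeometry Ψ U x ε →
        ε ≤ K * (⨅ ℓ, (CompressedSSC.clusterInradius U x z ℓ
            - CompressedSSC.subspaceIncoherence lam U x z ℓ)) ^ 2 * lam ^ (3 / 2 : ℝ) →
        CompressedSSC.LassoSSCDetects lam (CompressedSSC.compressedData Ψ x) z := by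
  refine ⟨1 / 1024, by norm_num, ?_⟩
  intro d p N k U x z Ψ lam ε hxU hx1 hμρ hlam hlamρ hΨ hε C hC i
  have hρ : (⨅ ℓ, CompressedSSC.clusterInradius U x z ℓ)
      ≤ CompressedSSC.clusterInradius U x z (z i) :=
    ciInf_le (Set.finite_range _).bddBelow (z i)
  have hΔ := ciInf_le (f := fun ℓ => CompressedSSC.clusterInradius U x z ℓ
    - CompressedSSC.subspaceIncoherence lam U x z ℓ) (Set.finite_range _).bddBelow (z i)
  have : Nonempty (Fin k) := ⟨z i⟩
  have hΔ0 : 0 ≤ ⨅ ℓ, (CompressedSSC.clusterInradius U x z ℓ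
      - CompressedSSC.subspaceIncoherence lam U x z ℓ) :=
    le_ciInf fun ℓ => (sub_pos.2 (hμρ ℓ)).le
  have hρ1 := CompressedSSC.clusterInradius_le_one (z := z) hxU hx1 i
  have hμ0 := CompressedSSC.subspaceIncoherence_nonneg lam U x z (z i)
  have hlamρi : lam < CompressedSSC.clusterInradius U x z (z i) / 2 := by linarith
  -- The argument only needs `ε` of order `Δ ^ 2 * lam`; as `lam < 1 / 2`, the exponent 3/2 asks for
  -- more.
  have hpow : lam ^ (3 / 2 : ℝ) ≤ lam := by
    have h := Real.rpow_le_rpow_of_exponent_ge hlam (by linarith)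
      (show (1 : ℝ) ≤ 3 / 2 by norm_num)
    rwa [Real.rpow_one] at h
  have hε0 : 0 ≤ ε := (abs_nonneg _).trans (hΨ.abs_norm_sub_one_le hx1 i)
  have hεi : ε ≤ (CompressedSSC.clusterInradius U x z (z i)
      - CompressedSSC.subspaceIncoherence lam U x z (z i)) ^ 2 * lam / 1024 := by
    refine hε.trans ?_
    have h := mul_le_mul (pow_le_pow_left₀ hΔ0 hΔ 2) hpow (by positivity) (by positivity)
    linarith
  have hεlam : 1024 * ε ≤ lam := by
    have h : (CompressedSSC.clusterInradius U x z (z i)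
        - CompressedSSC.subspaceIncoherence lam U x z (z i)) ^ 2 ≤ 1 :=
      pow_le_one₀ (hΔ0.trans hΔ) (by linarith)
    nlinarith
  refine ⟨CompressedSSC.lasso_compressedData_ne_zero hxU hx1 hΨ hlam hlamρi (by linarith) hεlam
    (hC i).2, fun j hj => ?_⟩
  exact CompressedSSC.lasso_compressedData_support hxU hx1 hΨ hlam hε0 hlamρi hρ1
    (hμρ (z i)) hεi (hC i).1 (hC i).2 hj
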